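/- Let $\mathcal G$ be a second countable étale Cantor groupoid, i.e. a second countable topological groupoid (not assumed Hausdorff) whose range map $r:\mathcal G\to\mathcal G^{(0)}$ is a local homeomorphism onto its unit space and whose unit space $\mathcal G^{(0)}$ is homeomorphic to $\{0,1\}^{\mathbb N}$. A *slice* is a subset of $\mathcal G$ on which the source map $s$ and the range map $r$ are injective. Suppose that $\mathcal G$ is minimal (every $\mathcal G$-orbit is dense in $\mathcal G^{(0)}$) and purely infinite: for every clopen $U\subseteq\mathcal G^{(0)}$ there are compact open slices $S_1,S_2$ with $s(S_1)=s(S_2)=U$, $r(S_1)\cup r(S_2)\subseteq U$ and $r(S_1)\cap r(S_2)=\emptyset$. Let $\mu$ be a Borel probability measure on $\mathcal G^{(0)}$, and let $\nu_\mu(E)=\int_{\mathcal G^{(0)}}\#\big(E\cap s^{-1}(u)\big)\,\mathrm d\mu(u)$ for Borel $E\subseteq\mathcal G$. Assume that $\mu$ is quasi-invariant, i.e. $\nu_\mu(E)=0$ if and only if $\nu_\mu(E^{-1})=0$ for every Borel $E\subseteq\mathcal G$, and ergodic, i.e. every Borel $U\subseteq\mathcal G^{(0)}$ such that $s(g)\in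 U\Leftrightarrow r(g)\in U$ for $\nu_\mu$-almost every $g\in\mathcal G$ satisfies $\mu(U)=0$ or $\mu(\mathcal G^{(0)}\setminus U)=0$. Let $\mathfrak T(\mathcal G)$ be the topological full group: the group, under product and inversion of subsets, of all compact open slices $B$ with $s(B)=r(B)=\mathcal G^{(0)}$. It acts on $\mathcal G^{(0)}$ by letting $B$ act as the homeomorphism $r\circ(s|_B)^{-1}$. Then $\mathfrak T(\mathcal G)$ is countable (so it is a locally compact second countable group when given the discrete topology), and its action on $(\mathcal G^{(0)},\mu)$ is measure contracting. That is, every $g\in\mathfrak T(\mathcal G)$ acts measurably, $\mu$ and $g_*\mu$ are mutually absolutely continuous for every $g\in\mathfrak T(\mathcal G)$, and for every measurable $A\subseteq\mathcal G^{(0)}$ and all real $M,\varepsilon>0$ there is $g\in\mathfrak T(\mathcal G)$ such that $$\mu\big(\{x: gx\neq x\}\setminus A\big)<\varepsilon\qquad\text{and}\qquad \mu\Big(\Big\{x\in A:\sqrt{\tfrac{\mathrm d\mu(gx)}{\mathrm d\mu(x)}}<M^{-1}\Big\}\Big)>\mu(A)-\varepsilon ,$$ where $\frac{\mathrm d\mu(gx)}{\mathrm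 d\mu(x)}$ denotes the Radon–Nikodym derivative with respect to $\mu$ of the measure $E\mapsto\mu(gE)$. -/

import Mathlib

open Set MeasureTheory Topology
open scoped ENNReal

/-! ### Groupoids, as sets of arrows with a partial product -/

/-- A groupoid: a set `G` with a product defined on a set of composable pairs and an inverse map
defined everywhere. -/
class ArrowGroupoid (G : Type*) where
  /-- the set of composable pairs -/
  composable : Set (G × G)
  /-- the product of a composable pair -/
  mul : (g h : G) → (g, h) ∈ composable → G
  /-- the inverse -/
  inv : G → G
  mul_composable : ∀ {g h k : G} (hgh : (g, h) ∈ composable), (h, k) ∈ composable →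
    (mul g h hgh, k) ∈ composable
  composable_mul : ∀ {g h k : G}, (g, h) ∈ composable → ∀ hhk : (h, k) ∈ composable,
    (g, mul h k hhk) ∈ composable
  mul_assoc : ∀ {g h k : G} (hgh : (g, h) ∈ composable) (hhk : (h, k) ∈ composable),
    mul (mul g h hgh) k (mul_composable hgh hhk) = mul g (mul h k hhk) (composable_mul hgh hhk)
  composable_inv : ∀ g : G, (g, inv g) ∈ composable
  inv_composable : ∀ g : G, (inv g, g) ∈ composable
  mul_mul_inv : ∀ {g h : G} (hgh : (g, h) ∈ composable),
    mul (mul g h hgh) (inv h) (mul_composable hgh (composable_inv h)) = g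
  inv_mul_mul : ∀ {g h : G} (hgh : (g, h) ∈ composable),
    mul (inv g) (mul g h hgh) (composable_mul (inv_composable g) hgh) = h

namespace ArrowGroupoid

section Algebra

variable {G : Type*} [ArrowGroupoid G]

theorem mul_congr {g g' h h' : G} (hg : g = g') (hh : h = h')
    (p : (g, h) ∈ composable (G := G)) :
    mul g h p = mul g' h' (by subst hg hh; exact p) := by
  subst hg hh; rfl

theorem mul_left_cancel' {g h k : G} (p : (g, h) ∈ composable (G := G))
    (q : (g, k) ∈ composable (G := G)) (e : mul g h p = mul g k q) : h = k := by
  rw [← inv_mul_mul p, ← inv_mul_mul q]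
  exact mul_congr rfl e _

theorem inv_inv' (g : G) : inv (inv g) = g := by
  have h1 : mul g (mul (inv g) g (inv_composable g))
      (composable_mul (composable_inv g) (inv_composable g)) = g := by
    have a := inv_mul_mul (composable_mul (composable_inv g) (inv_composable g))
    have b := inv_mul_mul (inv_composable g)
    apply mul_left_cancel' (composable_mul (inv_composable g)
      (composable_mul (composable_inv g) (inv_composable g))) (inv_composable g)
    exact a
  have h2 := mul_assoc (composable_inv g) (inv_composable g)
  have h3 := mul_mul_inv (composable_inv g)
  exact mul_left_cancel' _ _ (h3.trans (h1.symm.trans h2.symm))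

variable (G) in
/-- The set of units `g g⁻¹`. -/
def units : Set G := {u | ∃ g : G, u = mul g (inv g) (composable_inv g)}

variable (G) in
/-- The unit space, as a type. -/
abbrev UnitSpace : Type _ := {u : G // u ∈ units G}

/-- The range map `g ↦ g g⁻¹`. -/
def rng (g : G) : UnitSpace G := ⟨mul g (inv g) (composable_inv g), g, rfl⟩

/-- The source map `g ↦ g⁻¹ g`. -/
def src (g : G) : UnitSpace G :=
  ⟨mul (inv g) g (inv_composable g), inv g, mul_congr rfl (inv_inv' g).symm _⟩

theorem rng_inv (g : G) : rng (inv g) = src g :=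
  Subtype.ext (mul_congr rfl (inv_inv' g) _)

theorem src_inv (g : G) : src (inv g) = rng g :=
  Subtype.ext (mul_congr (inv_inv' g) rfl _)

theorem composable_src (g : G) : (g, (src g : G)) ∈ composable (G := G) :=
  composable_mul (composable_inv g) (inv_composable g)

theorem rng_composable (g : G) : ((rng g : G), g) ∈ composable (G := G) :=
  mul_composable (composable_inv g) (inv_composable g)

theorem rng_mul_self (g : G) : mul (rng g : G) g (rng_composable g) = g := by
  have h := mul_mul_inv (composable_inv g)
  exact (mul_congr rfl (inv_inv' g).symm _).trans h

theorem mul_src_self (g : G) : mul g (src g : G) (composable_src g) = g :=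
  (mul_assoc (composable_inv g) (inv_composable g)).symm.trans (rng_mul_self g)

theorem src_eq_rng {g h : G} (p : (g, h) ∈ composable (G := G)) : src g = rng h := by
  apply Subtype.ext
  have p1 : ((src g : G), h) ∈ composable (G := G) := mul_composable (inv_composable g) p
  have a : mul (src g : G) h p1 = h :=
    (mul_assoc (inv_composable g) p).trans (inv_mul_mul p)
  have b := mul_mul_inv p1
  exact b.symm.trans (mul_congr a rfl _)

theorem composable_iff {g h : G} : (g, h) ∈ composable (G := G) ↔ src g = rng h := by
  refine ⟨src_eq_rng, fun e => ?_⟩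
  have p := composable_src g
  have q := rng_composable h
  rw [← e] at q
  have := mul_composable p q
  rwa [mul_src_self] at this

theorem rng_mul {g h : G} (p : (g, h) ∈ composable (G := G)) : rng (mul g h p) = rng g := by
  have := src_eq_rng (composable_mul (inv_composable g) p)
  rw [← this, src_inv]

theorem src_mul {g h : G} (p : (g, h) ∈ composable (G := G)) :
    src (mul g h p) = src h := by
  have := src_eq_rng (mul_composable p (composable_inv h))
  rw [this, rng_inv]

theorem rng_unit (u : UnitSpace G) : rng (u : G) = u := by
  obtain ⟨_, g, rfl⟩ := u
  exact rng_mul _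

theorem src_unit (u : UnitSpace G) : src (u : G) = u := by
  obtain ⟨_, g, rfl⟩ := u
  exact (src_mul _).trans (src_inv g)

theorem unit_mul (u : UnitSpace G) {g : G} (p : ((u : G), g) ∈ composable (G := G)) :
    mul (u : G) g p = g := by
  have e : u = rng g := by rw [← src_unit u]; exact src_eq_rng p
  exact (mul_congr (congrArg Subtype.val e) rfl p).trans (rng_mul_self g)

theorem mul_unit (u : UnitSpace G) {g : G} (p : (g, (u : G)) ∈ composable (G := G)) :
    mul g (u : G) p = g := by
  have e : src g = u := by rw [← rng_unit u]; exact src_eq_rng p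
  exact (mul_congr rfl (congrArg Subtype.val e).symm p).trans (mul_src_self g)

/-- A slice (bisection): a set of arrows on which source and range are injective. -/
def IsSlice (B : Set G) : Prop := InjOn src B ∧ InjOn rng B

/-- The product of two sets of arrows. -/
def setMul (B C : Set G) : Set G :=
  {k | ∃ g ∈ B, ∃ h ∈ C, ∃ p : (g, h) ∈ composable (G := G), k = mul g h p}

/-- The set of inverses of a set of arrows. -/
def setInv (B : Set G) : Set G := inv '' B

variable (G) in
/-- The orbit of a unit. -/
def orbit (u : UnitSpace G) : Set (UnitSpace G) := {v | ∃ g : G, src g = u ∧ rng g = v}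

end Algebra

/-! ### Topological, étale and Cantor groupoids -/

/-- Topological groupoids: product and inverse are continuous. -/
class IsTopologicalGroupoid (G : Type*) [TopologicalSpace G] [ArrowGroupoid G] : Prop where
  continuous_mul : Continuous fun p : composable (G := G) => mul p.1.1 p.1.2 p.2
  continuous_inv' : Continuous (inv : G → G)

/-- Étale groupoids: the range map onto the unit space (with the subspace topology) is a local
homeomorphism. -/
class IsEtaleGroupoid (G : Type*) [TopologicalSpace G] [ArrowGroupoid G] : Prop
    extends IsTopologicalGroupoid G where
  isLocalHomeomorph_rng : IsLocalHomeomorph (rng : G → UnitSpace G)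

/-- Cantor groupoids: the unit space is homeomorphic to `{0,1}^ℕ`. -/
class IsCantorGroupoid (G : Type*) [TopologicalSpace G] [ArrowGroupoid G] : Prop where
  homeomorph_cantor : Nonempty (UnitSpace G ≃ₜ (ℕ → Bool))

section Topology

variable {G : Type*} [TopologicalSpace G] [ArrowGroupoid G]

/-- A compact open slice. -/
def IsCompactOpenSlice (B : Set G) : Prop := IsSlice B ∧ IsOpen B ∧ IsCompact B

variable (G) in
/-- Every orbit is dense in the unit space. -/
def IsMinimal : Prop := ∀ u : UnitSpace G, Dense (orbit G u)

/-- Properly infinite sets of units. -/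
def IsProperlyInfinite (U : Set (UnitSpace G)) : Prop :=
  ∃ S₁ S₂ : Set G, IsCompactOpenSlice S₁ ∧ IsCompactOpenSlice S₂ ∧
    src '' S₁ = U ∧ src '' S₂ = U ∧ rng '' S₁ ∪ rng '' S₂ ⊆ U ∧
    Disjoint (rng '' S₁) (rng '' S₂)

variable (G) in
/-- Every clopen set of units is properly infinite. -/
def IsPurelyInfinite : Prop := ∀ U : Set (UnitSpace G), IsClopen U → IsProperlyInfinite U

section Etale

theorem continuous_inverse [IsTopologicalGroupoid G] : Continuous (inv : G → G) :=
  IsTopologicalGroupoid.continuous_inv'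

variable [IsEtaleGroupoid G]

variable (G) in
theorem isLocalHomeomorph_rng : IsLocalHomeomorph (rng : G → UnitSpace G) :=
  IsEtaleGroupoid.isLocalHomeomorph_rng

variable (G) in
theorem isLocalHomeomorph_src : IsLocalHomeomorph (src : G → UnitSpace G) := by
  let e : G ≃ₜ G := ⟨⟨inv, inv, inv_inv', inv_inv'⟩, continuous_inverse, continuous_inverse⟩
  have h := (isLocalHomeomorph_rng G).comp e.isLocalHomeomorph
  have : (rng ∘ e : G → UnitSpace G) = src := funext rng_inv
  rwa [this] at h

theorem continuousOn_invFunOn_src {B : Set G} (hB : IsOpen B) (hs : InjOn src B) :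
    ∃ f : UnitSpace G → G, ContinuousOn f (src '' B) ∧
      (∀ b ∈ B, f (src b) = b) ∧ ∀ u ∈ src '' B, f u ∈ B ∧ src (f u) = u := by
  classical
  rcases isEmpty_or_nonempty G with hG | hG
  · exact ⟨fun u => (hG.false u.1).elim, fun u => (hG.false u.1).elim, fun b => (hG.false b).elim,
      fun u => (hG.false u.1).elim⟩
  refine ⟨Function.invFunOn src B, ?_, fun b hb => hs.leftInvOn_invFunOn hb,
    fun u hu => ⟨Function.invFunOn_mem hu, Function.invFunOn_eq hu⟩⟩
  rintro _ ⟨b, hb, rfl⟩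
  rw [ContinuousWithinAt, hs.leftInvOn_invFunOn hb]
  intro V hV
  have hVB : src '' (V ∩ B) ∈ 𝓝 (src b) :=
    (isLocalHomeomorph_src G).isOpenMap.image_mem_nhds
      (Filter.inter_mem hV (hB.mem_nhds hb))
  refine mem_nhdsWithin_of_mem_nhds (Filter.mem_of_superset hVB ?_)
  rintro _ ⟨c, ⟨hcV, hcB⟩, rfl⟩
  simpa only [mem_preimage, hs.leftInvOn_invFunOn hcB] using hcV

variable (G) in
theorem isOpen_units : IsOpen (units G) := by
  rw [isOpen_iff_mem_nhds]
  intro u hu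
  obtain ⟨e, hue, he⟩ := isLocalHomeomorph_rng G u
  have hc : Continuous fun g : G => (rng g : G) :=
    continuous_subtype_val.comp (isLocalHomeomorph_rng G).continuous
  have hru : (rng u : G) = u := congrArg Subtype.val (rng_unit ⟨u, hu⟩)
  have h1 : e.source ∈ 𝓝 u := e.open_source.mem_nhds hue
  have h2 : (fun g : G => (rng g : G)) ⁻¹' e.source ∈ 𝓝 u := by
    apply hc.continuousAt
    change e.source ∈ 𝓝 (rng u : G)
    rw [hru]
    exact h1
  filter_upwards [h1, h2] with g hg1 hg2
  have : g = (rng g : G) := by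
    refine e.injOn hg1 hg2 ?_
    rw [← he, rng_unit]
  rw [this]
  exact (rng g).2

theorem isOpen_setMul {B C : Set G} (hB : IsOpen B) (hC : IsOpen C) : IsOpen (setMul B C) := by
  rw [isOpen_iff_mem_nhds]
  rintro _ ⟨g, hg, h, hh, p, rfl⟩
  obtain ⟨e, hhe, he⟩ := isLocalHomeomorph_src G h
  have hDo : IsOpen (C ∩ e.source) := hC.inter e.open_source
  have hDi : InjOn src (C ∩ e.source) := by
    rw [he]; exact e.injOn.mono inter_subset_right
  obtain ⟨f, hfc, hfl, hfr⟩ := continuousOn_invFunOn_src hDo hDi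
  have hDs : IsOpen (src '' (C ∩ e.source)) :=
    (isLocalHomeomorph_src G).isOpenMap _ hDo
  have hsc := (isLocalHomeomorph_src G).continuous
  -- the arrows whose source lies in the source of the neighbourhood of `h`
  let W : Set G := src ⁻¹' (src '' (C ∩ e.source))
  have hW : IsOpen W := hDs.preimage hsc
  have hcomp : ∀ k : W, ((k : G), inv (f (src (k : G)))) ∈ composable (G := G) := fun k => by
    rw [composable_iff, rng_inv]
    exact ((hfr _ k.2).2).symm
  let φ : W → G := fun k => mul (k : G) (inv (f (src (k : G)))) (hcomp k)
  have hφ : Continuous φ := by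
    have h1 : Continuous fun k : W => f (src (k : G)) :=
      (hfc.comp (s := W) hsc.continuousOn (fun _ hx => hx)).domRestrict
    have h2 : Continuous fun k : W => ((⟨((k : G), inv (f (src (k : G)))), hcomp k⟩ :
        composable (G := G))) :=
      (continuous_subtype_val.prodMk (continuous_inverse.comp h1)).subtype_mk _
    exact IsTopologicalGroupoid.continuous_mul.comp h2
  have hkW : mul g h p ∈ W := by
    change src (mul g h p) ∈ src '' (C ∩ e.source)
    rw [src_mul]
    exact ⟨h, ⟨hh, hhe⟩, rfl⟩
  have hφk : φ ⟨mul g h p, hkW⟩ = g := by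
    have : f (src (mul g h p)) = h := by rw [src_mul]; exact hfl h ⟨hh, hhe⟩
    exact (mul_congr rfl (congrArg inv this) _).trans (mul_mul_inv p)
  have hpre : IsOpen (φ ⁻¹' B) := hB.preimage hφ
  have himg : IsOpen (Subtype.val '' (φ ⁻¹' B)) := hW.isOpenMap_subtype_val _ hpre
  refine Filter.mem_of_superset (himg.mem_nhds ⟨⟨_, hkW⟩, ?_, rfl⟩) ?_
  · change φ _ ∈ B
    rw [hφk]; exact hg
  · rintro _ ⟨k, hk, rfl⟩
    refine ⟨φ k, hk, f (src (k : G)), (hfr _ k.2).1.1, ?_, ?_⟩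
    · rw [composable_iff, src_mul, src_inv]
    · have := mul_mul_inv (hcomp k)
      exact this.symm.trans (mul_congr rfl (inv_inv' _) _)

theorem isCompact_setMul {B C : Set G} (hB : IsOpen B) (hBs : InjOn src B)
    (hBu : src '' B = univ) (hC : IsCompact C) : IsCompact (setMul B C) := by
  obtain ⟨f, hfc, hfl, hfr⟩ := continuousOn_invFunOn_src hB hBs
  rw [hBu, continuousOn_univ] at hfc
  have hcomp : ∀ k : G, (f (rng k), k) ∈ composable (G := G) := fun k => by
    rw [composable_iff]
    exact (hfr _ (hBu ▸ mem_univ _)).2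
  have hφ : Continuous fun k : G => mul (f (rng k)) k (hcomp k) := by
    have h2 : Continuous fun k : G => ((⟨(f (rng k), k), hcomp k⟩ : composable (G := G))) :=
      ((hfc.comp (isLocalHomeomorph_rng G).continuous).prodMk continuous_id).subtype_mk _
    exact IsTopologicalGroupoid.continuous_mul.comp h2
  convert hC.image hφ using 1
  ext k
  constructor
  · rintro ⟨g, hg, h, hh, p, rfl⟩
    refine ⟨h, hh, mul_congr ?_ rfl _⟩
    rw [← src_eq_rng p]
    exact hfl g hg
  · rintro ⟨h, hh, rfl⟩
    exact ⟨_, (hfr _ (hBu ▸ mem_univ _)).1, h, hh, hcomp h, rfl⟩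

end Etale

end Topology

/-! ### The topological full group and its action on the unit space -/

/-- Elements of the topological full group: compact open slices whose source and range are the
whole unit space. -/
@[ext]
structure TopologicalFullGroup (G : Type*) [TopologicalSpace G] [ArrowGroupoid G] where
  /-- the slice -/
  carrier : Set G
  isCompactOpenSlice : IsCompactOpenSlice carrier
  src_image : src '' carrier = univ
  rng_image : rng '' carrier = univ

namespace TopologicalFullGroup

variable {G : Type*} [TopologicalSpace G] [ArrowGroupoid G]

theorem exists_src (B : TopologicalFullGroup G) (u : UnitSpace G) :
    ∃ g ∈ B.carrier, src g = u := by
  have : u ∈ src '' B.carrier := B.src_image ▸ mem_univ u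
  exact this

theorem exists_rng (B : TopologicalFullGroup G) (u : UnitSpace G) :
    ∃ g ∈ B.carrier, rng g = u := by
  have : u ∈ rng '' B.carrier := B.rng_image ▸ mem_univ u
  exact this

/-- The homeomorphism `r ∘ (s|_B)⁻¹` of the unit space induced by a slice `B`, as a map: `u` goes
to the range of the unique arrow of `B` with source `u`. -/
noncomputable def act (B : TopologicalFullGroup G) (u : UnitSpace G) : UnitSpace G :=
  rng (B.exists_src u).choose

theorem act_src (B : TopologicalFullGroup G) {g : G} (hg : g ∈ B.carrier) :
    B.act (src g) = rng g := by
  have h := (B.exists_src (src g)).choose_spec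
  exact congrArg rng (B.isCompactOpenSlice.1.1 h.1 hg h.2)

variable [IsEtaleGroupoid G]

instance : Mul (TopologicalFullGroup G) where
  mul B C :=
    { carrier := setMul B.carrier C.carrier
      isCompactOpenSlice := by
        refine ⟨⟨?_, ?_⟩, isOpen_setMul B.isCompactOpenSlice.2.1 C.isCompactOpenSlice.2.1,
          isCompact_setMul B.isCompactOpenSlice.2.1 B.isCompactOpenSlice.1.1 B.src_image
            C.isCompactOpenSlice.2.2⟩
        · rintro _ ⟨g, hg, h, hh, p, rfl⟩ _ ⟨g', hg', h', hh', p', rfl⟩ e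
          rw [src_mul, src_mul] at e
          have e1 := C.isCompactOpenSlice.1.1 hh hh' e
          subst e1
          have e2 := B.isCompactOpenSlice.1.1 hg hg'
            ((src_eq_rng p).trans (src_eq_rng p').symm)
          subst e2
          rfl
        · rintro _ ⟨g, hg, h, hh, p, rfl⟩ _ ⟨g', hg', h', hh', p', rfl⟩ e
          rw [rng_mul, rng_mul] at e
          have e1 := B.isCompactOpenSlice.1.2 hg hg' e
          subst e1
          have e2 := C.isCompactOpenSlice.1.2 hh hh'
            ((src_eq_rng p).symm.trans (src_eq_rng p'))
          subst e2
          rfl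
      src_image := by
        refine eq_univ_of_forall fun u => ?_
        obtain ⟨h, hh, rfl⟩ := C.exists_src u
        obtain ⟨g, hg, e⟩ := B.exists_src (rng h)
        exact ⟨_, ⟨g, hg, h, hh, composable_iff.2 e, rfl⟩, src_mul _⟩
      rng_image := by
        refine eq_univ_of_forall fun u => ?_
        obtain ⟨g, hg, rfl⟩ := B.exists_rng u
        obtain ⟨h, hh, e⟩ := C.exists_rng (src g)
        exact ⟨_, ⟨g, hg, h, hh, composable_iff.2 e.symm, rfl⟩, rng_mul _⟩ }

instance : Inv (TopologicalFullGroup G) where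
  inv B :=
    { carrier := setInv B.carrier
      isCompactOpenSlice := by
        refine ⟨⟨?_, ?_⟩, ?_, B.isCompactOpenSlice.2.2.image continuous_inverse⟩
        · rintro _ ⟨g, hg, rfl⟩ _ ⟨h, hh, rfl⟩ e
          rw [src_inv, src_inv] at e
          rw [B.isCompactOpenSlice.1.2 hg hh e]
        · rintro _ ⟨g, hg, rfl⟩ _ ⟨h, hh, rfl⟩ e
          rw [rng_inv, rng_inv] at e
          rw [B.isCompactOpenSlice.1.1 hg hh e]
        · have : setInv B.carrier = inv ⁻¹' B.carrier := by
            ext k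
            constructor
            · rintro ⟨g, hg, rfl⟩
              rwa [mem_preimage, inv_inv']
            · intro hk
              exact ⟨inv k, hk, inv_inv' k⟩
          rw [this]
          exact B.isCompactOpenSlice.2.1.preimage continuous_inverse
      src_image := by
        refine eq_univ_of_forall fun u => ?_
        obtain ⟨g, hg, rfl⟩ := B.exists_rng u
        exact ⟨_, ⟨g, hg, rfl⟩, src_inv g⟩
      rng_image := by
        refine eq_univ_of_forall fun u => ?_
        obtain ⟨g, hg, rfl⟩ := B.exists_src u
        exact ⟨_, ⟨g, hg, rfl⟩, rng_inv g⟩ }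

theorem carrier_mul (B C : TopologicalFullGroup G) :
    (B * C).carrier = setMul B.carrier C.carrier := rfl

theorem carrier_inv (B : TopologicalFullGroup G) : (B⁻¹).carrier = setInv B.carrier := rfl

variable [IsCantorGroupoid G]

instance : One (TopologicalFullGroup G) where
  one :=
    { carrier := units G
      isCompactOpenSlice := by
        refine ⟨⟨?_, ?_⟩, isOpen_units G, ?_⟩
        · intro u hu v hv e
          have := (src_unit ⟨u, hu⟩).symm.trans (e.trans (src_unit ⟨v, hv⟩))
          exact congrArg Subtype.val this
        · intro u hu v hv e
          have := (rng_unit ⟨u, hu⟩).symm.trans (e.trans (rng_unit ⟨v, hv⟩))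
          exact congrArg Subtype.val this
        · obtain ⟨e⟩ := IsCantorGroupoid.homeomorph_cantor (G := G)
          have : CompactSpace (UnitSpace G) := e.symm.compactSpace
          exact isCompact_iff_compactSpace.2 this
      src_image := eq_univ_of_forall fun u => ⟨u, u.2, src_unit u⟩
      rng_image := eq_univ_of_forall fun u => ⟨u, u.2, rng_unit u⟩ }

theorem carrier_one : (1 : TopologicalFullGroup G).carrier = units G := rfl

/-- The topological full group, with product and inversion of subsets. -/
instance : Group (TopologicalFullGroup G) :=
  Group.ofLeftAxioms
    (by
      intro B C D
      ext k
      constructor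
      · rintro ⟨_, ⟨g, hg, h, hh, p, rfl⟩, l, hl, q, rfl⟩
        have hc : (h, l) ∈ composable (G := G) := by
          have := src_eq_rng q
          rw [src_mul] at this
          exact composable_iff.2 this
        exact ⟨g, hg, _, ⟨h, hh, l, hl, hc, rfl⟩, composable_mul p hc, mul_assoc p hc⟩
      · rintro ⟨g, hg, _, ⟨h, hh, l, hl, q, rfl⟩, p, rfl⟩
        have hc : (g, h) ∈ composable (G := G) := by
          have := src_eq_rng p
          rw [rng_mul] at this
          exact composable_iff.2 this
        exact ⟨_, ⟨g, hg, h, hh, hc, rfl⟩, l, hl, mul_composable hc q, (mul_assoc hc q).symm⟩)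
    (by
      intro B
      ext k
      constructor
      · rintro ⟨u, hu, g, hg, p, rfl⟩
        rw [unit_mul ⟨u, hu⟩ p]
        exact hg
      · intro hk
        exact ⟨_, (rng k).2, k, hk, rng_composable k, (rng_mul_self k).symm⟩)
    (by
      intro B
      ext k
      constructor
      · rintro ⟨_, ⟨g, hg, rfl⟩, h, hh, p, rfl⟩
        have e := src_eq_rng p
        rw [src_inv] at e
        have e1 := B.isCompactOpenSlice.1.2 hg hh e
        subst e1
        exact (src g).2
      · intro hk
        obtain ⟨g, hg, e⟩ := B.exists_src ⟨k, hk⟩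
        exact ⟨_, ⟨g, hg, rfl⟩, g, hg, inv_composable g, (congrArg Subtype.val e).symm⟩)

/-- The natural action of the topological full group on the unit space. -/
noncomputable instance : MulAction (TopologicalFullGroup G) (UnitSpace G) where
  smul B u := B.act u
  one_smul u := by
    have h := act_src (1 : TopologicalFullGroup G) (g := (u : G)) u.2
    rw [src_unit, rng_unit] at h
    exact h
  mul_smul B C u := by
    obtain ⟨h, hh, rfl⟩ := C.exists_src u
    obtain ⟨g, hg, e⟩ := B.exists_src (rng h)
    have p : (g, h) ∈ composable (G := G) := composable_iff.2 e
    have h1 := act_src (B * C) (g := mul g h p) ⟨g, hg, h, hh, p, rfl⟩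
    rw [src_mul, rng_mul] at h1
    change (B * C).act (src h) = B.act (C.act (src h))
    rw [h1, act_src C hh, ← e, act_src B hg]

end TopologicalFullGroup

/-! ### Quasi-invariant and ergodic measures on the unit space -/

section Measures

variable {G : Type*} [ArrowGroupoid G] [MeasurableSpace G]

/-- The value on a set `E` of arrows of the measure `ν_μ = ∫ ν_u dμ(u)` induced by a measure `μ` on
the unit space, where `ν_u` is the counting measure on the source fibre of `u` (the canonical Haar
system of an étale groupoid). -/
noncomputable def inducedMeasure (μ : Measure (UnitSpace G)) (E : Set G) : ℝ≥0∞ :=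
  ∫⁻ u, ((E ∩ {g | src g = u}).encard : ℝ≥0∞) ∂μ

/-- `μ` is quasi-invariant: `ν_μ` and its image `ν_μ⁻¹` under inversion have the same null sets
among the measurable sets of arrows. -/
def IsQuasiInvariant (μ : Measure (UnitSpace G)) : Prop :=
  ∀ E : Set G, MeasurableSet E → (inducedMeasure μ E = 0 ↔ inducedMeasure μ (setInv E) = 0)

/-- `U` is almost invariant: for `ν_μ`-almost every arrow `g`, `s(g) ∈ U` iff `r(g) ∈ U`. -/
def IsAlmostInvariant (μ : Measure (UnitSpace G)) (U : Set (UnitSpace G)) : Prop :=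
  inducedMeasure μ {g | ¬ (src g ∈ U ↔ rng g ∈ U)} = 0

/-- Ergodicity: almost invariant measurable sets are null or conull. -/
def IsErgodic (μ : Measure (UnitSpace G)) : Prop :=
  ∀ U : Set (UnitSpace G), MeasurableSet U → IsAlmostInvariant μ U → μ U = 0 ∨ μ Uᶜ = 0

end Measures

end ArrowGroupoid

/-! ### Measure contracting actions -/

/-- The action of a group `Γ` on a probability space `(X, μ)` is measure contracting: every group
element acts measurably and preserves the measure class of `μ`, and for all measurable `A` and
`M, ε > 0` there is `g` whose support `{x | g x ≠ x}` lies in `A` up to measure less than `ε` and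
with `√(dμ(gx)/dμ(x)) < M⁻¹` on `A` up to measure less than `ε`. Here `dμ(gx)/dμ(x)` is the
density with respect to `μ` of the measure `E ↦ μ (g E)`, the image of `μ` under `g⁻¹`. -/
structure IsMeasureContracting (Γ : Type*) {X : Type*} [Group Γ] [MulAction Γ X]
    [MeasurableSpace X] (μ : Measure X) : Prop where
  measurable_smul : ∀ g : Γ, Measurable fun x : X => g • x
  measureClassPreserving : ∀ g : Γ,
    μ.map (fun x => g • x) ≪ μ ∧ μ ≪ μ.map (fun x => g • x)
  contracting : ∀ A : Set X, MeasurableSet A → ∀ M ε : ℝ, 0 < M → 0 < ε → ∃ g : Γ,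
    μ.real ({x | g • x ≠ x} \ A) < ε ∧
    μ.real {x ∈ A | ((μ.map (fun y => g⁻¹ • y)).rnDeriv μ x) ^ (1 / 2 : ℝ) < ENNReal.ofReal M⁻¹}
      > μ.real A - ε

/-! The full group is countable because its elements are compact open sets, and in a second
countable space each of these is a finite union of members of a countable basis.

For contraction, approximate `A` in measure by a clopen set `U`. Pure infiniteness puts two disjoint
copies of a clopen set inside itself, and one of them carries at most half of its measure. Iterating
gives a nonempty clopen `W ⊆ U` as small as desired (`IsPurelyInfinite.exists_isClopen_measure_lt`).
Minimality and pure infiniteness together give a compact open slice carrying the whole unit space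
into `W` (`exists_isCompactOpenSlice_univ`). Cut down to the source `U \ W`, this slice has disjoint
source and range. Together with its inverse and the remaining units it is an element `g` of the full
group, supported in `U` and moving `U \ W` into `W` (`exists_topologicalFullGroup_contracting`).

Thus `E ↦ μ (g E)` gives `U \ W` mass at most `μ W`, and Markov's inequality
(`mul_measure_rnDeriv_ge_le`) makes its density small on `U` outside a set of small measure.
Quasi-invariance is what preserves the measure class. -/

theorem countable_setOf_isOpen_isCompact (X : Type*) [TopologicalSpace X]
    [SecondCountableTopology X] : {K : Set X | IsOpen K ∧ IsCompact K}.Countable := by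
  have hb := TopologicalSpace.isBasis_countableBasis X
  have : Countable (TopologicalSpace.countableBasis X) :=
    (TopologicalSpace.countable_countableBasis X).to_subtype
  refine (countable_range fun s : Finset (TopologicalSpace.countableBasis X) =>
    ⋃ i ∈ s, (i : Set X)).mono ?_
  rintro K ⟨hKo, hKc⟩
  obtain ⟨s, hs, rfl⟩ := eq_finite_iUnion_of_isTopologicalBasis_of_isCompact_open
    (fun i : TopologicalSpace.countableBasis X => (i : Set X)) (by simpa using hb) K hKc hKo
  exact ⟨hs.toFinset, by simp⟩

namespace ArrowGroupoid

/-! ### Sources and ranges of products and inverses of slices. -/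

section SliceAlgebra

variable {G : Type*} [ArrowGroupoid G]

theorem IsSlice.mono {B C : Set G} (hC : IsSlice C) (h : B ⊆ C) : IsSlice B :=
  ⟨hC.1.mono h, hC.2.mono h⟩

theorem IsSlice.union {B C : Set G} (hB : IsSlice B) (hC : IsSlice C)
    (hs : Disjoint (src '' B) (src '' C)) (hr : Disjoint (rng '' B) (rng '' C)) :
    IsSlice (B ∪ C) := by
  have hd : ∀ {f : G → UnitSpace G}, Disjoint (f '' B) (f '' C) →
      ∀ b ∈ B, ∀ c ∈ C, f b ≠ f c := fun h b hb c hc =>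
    disjoint_iff_forall_ne.1 h (mem_image_of_mem _ hb) (mem_image_of_mem _ hc)
  have hBC : Disjoint B C := hs.of_image
  exact ⟨(injOn_union hBC).2 ⟨hB.1, hC.1, hd hs⟩, (injOn_union hBC).2 ⟨hB.2, hC.2, hd hr⟩⟩

theorem src_image_setInv (B : Set G) : src '' setInv B = rng '' B := by
  simp only [setInv, image_image, src_inv]

theorem rng_image_setInv (B : Set G) : rng '' setInv B = src '' B := by
  simp only [setInv, image_image, rng_inv]

theorem src_image_units (U : Set (UnitSpace G)) : src '' (Subtype.val '' U : Set G) = U := by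
  simp only [image_image, src_unit, image_id']

theorem rng_image_units (U : Set (UnitSpace G)) : rng '' (Subtype.val '' U : Set G) = U := by
  simp only [image_image, rng_unit, image_id']

theorem src_image_inter_preimage (B : Set G) (U : Set (UnitSpace G)) :
    src '' (B ∩ src ⁻¹' U) = src '' B ∩ U := image_inter_preimage _ _ _

theorem setInv_eq_preimage (B : Set G) : setInv B = inv ⁻¹' B :=
  congrFun (image_eq_preimage_of_inverse inv_inv' inv_inv') B

theorem IsSlice.setMul {B C : Set G} (hB : IsSlice B) (hC : IsSlice C) :
    IsSlice (setMul B C) := by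
  constructor
  · rintro _ ⟨g, hg, h, hh, p, rfl⟩ _ ⟨g', hg', h', hh', p', rfl⟩ e
    rw [src_mul, src_mul] at e
    have e1 := hC.1 hh hh' e
    subst e1
    have e2 := hB.1 hg hg' ((src_eq_rng p).trans (src_eq_rng p').symm)
    subst e2
    rfl
  · rintro _ ⟨g, hg, h, hh, p, rfl⟩ _ ⟨g', hg', h', hh', p', rfl⟩ e
    rw [rng_mul, rng_mul] at e
    have e1 := hB.2 hg hg' e
    subst e1
    have e2 := hC.2 hh hh' ((src_eq_rng p).symm.trans (src_eq_rng p'))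
    subst e2
    rfl

theorem src_image_setMul {B C : Set G} (h : rng '' C ⊆ src '' B) :
    src '' setMul B C = src '' C := by
  ext u
  constructor
  · rintro ⟨_, ⟨g, hg, k, hk, p, rfl⟩, rfl⟩
    exact ⟨k, hk, (src_mul p).symm⟩
  · rintro ⟨k, hk, rfl⟩
    obtain ⟨g, hg, e⟩ := h (mem_image_of_mem _ hk)
    exact ⟨_, ⟨g, hg, k, hk, composable_iff.2 e, rfl⟩, src_mul _⟩

theorem rng_image_setMul_subset (B C : Set G) : rng '' setMul B C ⊆ rng '' B := by
  rintro _ ⟨_, ⟨g, hg, k, hk, p, rfl⟩, rfl⟩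
  exact ⟨g, hg, (rng_mul p).symm⟩

end SliceAlgebra

/-! ### Compact open slices and their construction. -/

section Slices

variable {G : Type*} [TopologicalSpace G] [ArrowGroupoid G]

theorem IsCompactOpenSlice.union {B C : Set G} (hB : IsCompactOpenSlice B)
    (hC : IsCompactOpenSlice C) (hs : Disjoint (src '' B) (src '' C))
    (hr : Disjoint (rng '' B) (rng '' C)) : IsCompactOpenSlice (B ∪ C) :=
  ⟨hB.1.union hC.1 hs hr, hB.2.1.union hC.2.1, hB.2.2.union hC.2.2⟩

theorem isCompactOpenSlice_empty : IsCompactOpenSlice (∅ : Set G) :=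
  ⟨⟨injOn_empty _, injOn_empty _⟩, isOpen_empty, isCompact_empty⟩

theorem unitSpace_compactSpace [IsCantorGroupoid G] : CompactSpace (UnitSpace G) := by
  obtain ⟨e⟩ := IsCantorGroupoid.homeomorph_cantor (G := G)
  exact e.symm.compactSpace

theorem unitSpace_t2Space [IsCantorGroupoid G] : T2Space (UnitSpace G) := by
  obtain ⟨e⟩ := IsCantorGroupoid.homeomorph_cantor (G := G)
  exact e.symm.t2Space

theorem unitSpace_totallyDisconnectedSpace [IsCantorGroupoid G] :
    TotallyDisconnectedSpace (UnitSpace G) := by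
  obtain ⟨e⟩ := IsCantorGroupoid.homeomorph_cantor (G := G)
  exact e.symm.totallyDisconnectedSpace

theorem unitSpace_metrizableSpace [IsCantorGroupoid G] :
    TopologicalSpace.MetrizableSpace (UnitSpace G) := by
  obtain ⟨e⟩ := IsCantorGroupoid.homeomorph_cantor (G := G)
  exact e.isEmbedding.metrizableSpace

variable [IsEtaleGroupoid G]

/-- The continuous section of the source map over `src '' B` has image `B`. Since `G` need not be
Hausdorff, compactness of slices is always read off from their sources. -/
theorem isCompact_of_isCompact_src_image {B : Set G} (hB : IsOpen B) (hs : InjOn src B)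
    (hc : IsCompact (src '' B)) : IsCompact B := by
  obtain ⟨f, hf, hl, hr⟩ := continuousOn_invFunOn_src hB hs
  convert hc.image_of_continuousOn hf using 1
  rw [image_image]
  ext b
  refine ⟨fun hb => ⟨b, hb, hl b hb⟩, ?_⟩
  rintro ⟨c, hc, rfl⟩
  simpa only [hl c hc] using hc

/-- The hypothesis `h` lets every arrow of `C` be composed with one of `B`, so the product keeps the
compact source of `C`. -/
theorem IsCompactOpenSlice.setMul {B C : Set G} (hB : IsCompactOpenSlice B)
    (hC : IsCompactOpenSlice C) (h : rng '' C ⊆ src '' B) :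
    IsCompactOpenSlice (setMul B C) := by
  have ho := isOpen_setMul hB.2.1 hC.2.1
  have hs := hB.1.setMul hC.1
  refine ⟨hs, ho, isCompact_of_isCompact_src_image ho hs.1 ?_⟩
  rw [src_image_setMul h]
  exact hC.2.2.image (isLocalHomeomorph_src G).continuous

theorem IsCompactOpenSlice.setInv {B : Set G} (hB : IsCompactOpenSlice B) :
    IsCompactOpenSlice (setInv B) := by
  refine ⟨⟨?_, ?_⟩, ?_, hB.2.2.image continuous_inverse⟩
  · rintro _ ⟨g, hg, rfl⟩ _ ⟨h, hh, rfl⟩ e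
    rw [src_inv, src_inv] at e
    rw [hB.1.2 hg hh e]
  · rintro _ ⟨g, hg, rfl⟩ _ ⟨h, hh, rfl⟩ e
    rw [rng_inv, rng_inv] at e
    rw [hB.1.1 hg hh e]
  · rw [setInv_eq_preimage]
    exact hB.2.1.preimage continuous_inverse

variable [IsCantorGroupoid G]

theorem IsCompactOpenSlice.isClopen_src_image {B : Set G} (hB : IsCompactOpenSlice B) :
    IsClopen (src '' B) :=
  have := unitSpace_t2Space (G := G)
  ⟨(hB.2.2.image (isLocalHomeomorph_src G).continuous).isClosed,
    (isLocalHomeomorph_src G).isOpenMap _ hB.2.1⟩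

theorem IsCompactOpenSlice.isClopen_rng_image {B : Set G} (hB : IsCompactOpenSlice B) :
    IsClopen (rng '' B) :=
  have := unitSpace_t2Space (G := G)
  ⟨(hB.2.2.image (isLocalHomeomorph_rng G).continuous).isClosed,
    (isLocalHomeomorph_rng G).isOpenMap _ hB.2.1⟩

/-- Compactness of `B` is not assumed, so that a merely open slice can be cut down to a compact one.
-/
theorem IsSlice.isCompactOpenSlice_inter_src_preimage {B : Set G} (hB : IsSlice B)
    (ho : IsOpen B) {U : Set (UnitSpace G)} (hU : IsClopen U) (h : IsClosed (src '' B ∩ U)) :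
    IsCompactOpenSlice (B ∩ src ⁻¹' U) := by
  have := unitSpace_compactSpace (G := G)
  have ho' : IsOpen (B ∩ src ⁻¹' U) :=
    ho.inter (hU.isOpen.preimage (isLocalHomeomorph_src G).continuous)
  have hs := hB.mono (inter_subset_left (t := src ⁻¹' U))
  refine ⟨hs, ho', isCompact_of_isCompact_src_image ho' hs.1 ?_⟩
  rw [src_image_inter_preimage]
  exact h.isCompact

theorem IsCompactOpenSlice.inter_src_preimage {B : Set G} (hB : IsCompactOpenSlice B)
    {U : Set (UnitSpace G)} (hU : IsClopen U) : IsCompactOpenSlice (B ∩ src ⁻¹' U) :=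
  hB.1.isCompactOpenSlice_inter_src_preimage hB.2.1 hU
    (hB.isClopen_src_image.isClosed.inter hU.isClosed)

theorem isCompactOpenSlice_units {U : Set (UnitSpace G)} (hU : IsClopen U) :
    IsCompactOpenSlice (Subtype.val '' U : Set G) := by
  have := unitSpace_compactSpace (G := G)
  refine ⟨⟨?_, ?_⟩, (isOpen_units G).isOpenMap_subtype_val _ hU.isOpen,
    hU.isClosed.isCompact.image continuous_subtype_val⟩
  · rintro _ ⟨u, -, rfl⟩ _ ⟨v, -, rfl⟩ e
    rw [src_unit, src_unit] at e
    rw [e]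
  · rintro _ ⟨u, -, rfl⟩ _ ⟨v, -, rfl⟩ e
    rw [rng_unit, rng_unit] at e
    rw [e]

/-- Every arrow lies in compact open slices whose range is contained in a given open set. -/
theorem exists_isCompactOpenSlice_mem (g : G) {V : Set (UnitSpace G)} (hV : IsOpen V)
    (hg : rng g ∈ V) : ∃ B : Set G, IsCompactOpenSlice B ∧ g ∈ B ∧ rng '' B ⊆ V := by
  have := unitSpace_compactSpace (G := G)
  have := unitSpace_t2Space (G := G)
  have := unitSpace_totallyDisconnectedSpace (G := G)
  obtain ⟨e, hge, he⟩ := isLocalHomeomorph_src G g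
  obtain ⟨e', hge', he'⟩ := isLocalHomeomorph_rng G g
  -- Both maps are injective on `O`; a clopen neighbourhood of `src g` inside `src '' O` then cuts
  -- out a compact piece.
  let O : Set G := e.source ∩ e'.source ∩ rng ⁻¹' V
  have hO : IsOpen O := (e.open_source.inter e'.open_source).inter
    (hV.preimage (isLocalHomeomorph_rng G).continuous)
  have hgO : g ∈ O := ⟨⟨hge, hge'⟩, hg⟩
  have hs : IsSlice O := by
    refine ⟨?_, ?_⟩
    · rw [he]; exact e.injOn.mono fun x hx => hx.1.1
    · rw [he']; exact e'.injOn.mono fun x hx => hx.1.2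
  obtain ⟨C, hC, hgC, hCO⟩ := compact_exists_isClopen_in_isOpen
    ((isLocalHomeomorph_src G).isOpenMap _ hO) (mem_image_of_mem src hgO)
  refine ⟨O ∩ src ⁻¹' C, hs.isCompactOpenSlice_inter_src_preimage hO hC ?_, ⟨hgO, hgC⟩, ?_⟩
  · rw [inter_eq_right.2 hCO]
    exact hC.isClosed
  · rintro _ ⟨k, hk, rfl⟩
    exact hk.1.2

/-- In a minimal purely infinite groupoid, the whole unit space embeds into every nonempty clopen
set. -/
theorem exists_isCompactOpenSlice_univ (hpi : IsPurelyInfinite G) (hmin : IsMinimal G)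
    {V : Set (UnitSpace G)} (hV : IsClopen V) (hne : V.Nonempty) :
    ∃ B : Set G, IsCompactOpenSlice B ∧ src '' B = univ ∧ rng '' B ⊆ V := by
  have := unitSpace_compactSpace (G := G)
  -- Compact induction needs a property inherited by subsets, hence an inclusion in place of the
  -- equality.
  suffices h : ∃ B : Set G, IsCompactOpenSlice B ∧ univ ⊆ src '' B ∧ rng '' B ⊆ V by
    obtain ⟨B, h1, h2, h3⟩ := h
    exact ⟨B, h1, univ_subset_iff.1 h2, h3⟩
  refine isCompact_univ.induction_on
    (p := fun D => ∃ B : Set G, IsCompactOpenSlice B ∧ D ⊆ src '' B ∧ rng '' B ⊆ V) ?_ ?_ ?_ ?_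
  · exact ⟨∅, isCompactOpenSlice_empty, by simp, by simp⟩
  · rintro s t hst ⟨B, h1, h2, h3⟩
    exact ⟨B, h1, hst.trans h2, h3⟩
  · rintro s t ⟨B, hB, hsB, hBV⟩ ⟨C, hC, htC, hCV⟩
    -- The ranges of `B` and `C` may overlap in `V`; composing with `S₁` and `S₂` pushes them into
    -- disjoint parts of `V`. Overlap of the sources is removed by trimming `C` to `C'`.
    obtain ⟨S₁, S₂, h1, h2, hs1, hs2, hr, hd⟩ := hpi V hV
    let C' : Set G := C ∩ src ⁻¹' (src '' B)ᶜ
    have hC' : IsCompactOpenSlice C' := hC.inter_src_preimage hB.isClopen_src_image.compl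
    have hsC' : src '' C' = src '' C ∩ (src '' B)ᶜ := src_image_inter_preimage _ _
    have hB1 : rng '' B ⊆ src '' S₁ := hs1 ▸ hBV
    have hC2 : rng '' C' ⊆ src '' S₂ := hs2 ▸ (image_mono inter_subset_left).trans hCV
    refine ⟨setMul S₁ B ∪ setMul S₂ C',
      (h1.setMul hB hB1).union (h2.setMul hC' hC2) ?_ ?_, ?_, ?_⟩
    · rw [src_image_setMul hB1, src_image_setMul hC2, hsC']
      exact disjoint_compl_right.mono_right inter_subset_right
    · exact hd.mono (rng_image_setMul_subset _ _) (rng_image_setMul_subset _ _)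
    · rw [image_union, src_image_setMul hB1, src_image_setMul hC2, hsC']
      intro u hu
      by_cases huB : u ∈ src '' B
      · exact Or.inl huB
      · exact Or.inr ⟨htC (hu.resolve_left fun h => huB (hsB h)), huB⟩
    · rw [image_union]
      exact (union_subset_union (rng_image_setMul_subset _ _)
        (rng_image_setMul_subset _ _)).trans hr
  -- By density of the orbit of `u`, some arrow leads from `u` into `V`; a slice around it serves a
  -- neighbourhood of `u`.
  · intro u _
    obtain ⟨_, hv, g, rfl, rfl⟩ := (hmin u).inter_open_nonempty V hV.isOpen hne
    obtain ⟨B, hB, hgB, hBV⟩ := exists_isCompactOpenSlice_mem g hV.isOpen hv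
    exact ⟨src '' B, mem_nhdsWithin_of_mem_nhds
      (hB.isClopen_src_image.isOpen.mem_nhds (mem_image_of_mem _ hgB)), B, hB, subset_rfl, hBV⟩

end Slices

/-! ### Countability of the full group, continuity of its action, and extension of slices to full
group elements. -/

section FullGroup

variable {G : Type*} [TopologicalSpace G] [ArrowGroupoid G]

theorem TopologicalFullGroup.countable [SecondCountableTopology G] :
    Countable (TopologicalFullGroup G) := by
  have := (countable_setOf_isOpen_isCompact G).to_subtype
  exact Function.Injective.countable
    (f := fun B : TopologicalFullGroup G =>
      (⟨B.carrier, B.isCompactOpenSlice.2⟩ : {K : Set G | IsOpen K ∧ IsCompact K}))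
    fun B C h => TopologicalFullGroup.ext (congrArg Subtype.val h)

variable [IsEtaleGroupoid G] [IsCantorGroupoid G]

theorem TopologicalFullGroup.smul_src (B : TopologicalFullGroup G) {g : G}
    (hg : g ∈ B.carrier) : B • src g = rng g := B.act_src hg

theorem TopologicalFullGroup.continuous_smul (B : TopologicalFullGroup G) :
    Continuous fun u : UnitSpace G => B • u := by
  obtain ⟨f, hf, -, hr⟩ := continuousOn_invFunOn_src B.isCompactOpenSlice.2.1
    B.isCompactOpenSlice.1.1
  rw [B.src_image, continuousOn_univ] at hf
  convert (isLocalHomeomorph_rng G).continuous.comp hf using 1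
  funext u
  obtain ⟨h1, h2⟩ := hr u (B.src_image ▸ mem_univ u)
  rw [Function.comp_apply, ← B.smul_src h1, h2]

/-- A compact open slice whose source and range are disjoint extends, together with its inverse
and the remaining units, to an element of the topological full group. -/
theorem IsCompactOpenSlice.exists_topologicalFullGroup {B : Set G} (hB : IsCompactOpenSlice B)
    (hd : Disjoint (src '' B) (rng '' B)) :
    ∃ g : TopologicalFullGroup G, (∀ u ∈ src '' B, g • u ∈ rng '' B) ∧
      ∀ u ∉ src '' B ∪ rng '' B, g • u = u := by
  let R : Set (UnitSpace G) := (src '' B ∪ rng '' B)ᶜ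
  have hR : IsClopen R := (hB.isClopen_src_image.union hB.isClopen_rng_image).compl
  -- Inversion exchanges source and range, so disjointness of the two is exactly what makes this
  -- union a slice.
  have h1 : IsCompactOpenSlice (B ∪ ArrowGroupoid.setInv B) := by
    refine hB.union hB.setInv ?_ ?_
    · rwa [src_image_setInv]
    · rw [rng_image_setInv]; exact hd.symm
  have hs : src '' (B ∪ ArrowGroupoid.setInv B) = src '' B ∪ rng '' B := by
    rw [image_union, src_image_setInv]
  have hr : rng '' (B ∪ ArrowGroupoid.setInv B) = src '' B ∪ rng '' B := by
    rw [image_union, rng_image_setInv, union_comm]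
  let g : TopologicalFullGroup G :=
    { carrier := (B ∪ ArrowGroupoid.setInv B) ∪ Subtype.val '' R
      isCompactOpenSlice := by
        refine h1.union (isCompactOpenSlice_units hR) ?_ ?_
        · rw [hs, src_image_units]; exact disjoint_compl_right
        · rw [hr, rng_image_units]; exact disjoint_compl_right
      src_image := by rw [image_union, hs, src_image_units]; exact union_compl_self _
      rng_image := by rw [image_union, hr, rng_image_units]; exact union_compl_self _ }
  refine ⟨g, ?_, fun u hu => ?_⟩
  · rintro _ ⟨b, hb, rfl⟩
    rw [g.smul_src (Or.inl (Or.inl hb))]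
    exact mem_image_of_mem _ hb
  · have := g.smul_src (g := (u : G)) (Or.inr ⟨u, hu, rfl⟩)
    rwa [src_unit, rng_unit] at this

end FullGroup

/-! ### Measure class preservation and contracting elements. -/

section Measures

theorem encard_inter_src_fiber {G : Type*} [ArrowGroupoid G] {E : Set G} (hE : InjOn src E) (u : UnitSpace G) :
    ((E ∩ {g | src g = u}).encard : ℝ≥0∞) = (src '' E).indicator 1 u := by
  classical
  by_cases hu : u ∈ src '' E
  · obtain ⟨g, hg, rfl⟩ := hu
    have : E ∩ {k | src k = src g} = {g} := by
      ext k
      exact ⟨fun h => hE h.1 hg h.2, by rintro rfl; exact ⟨hg, rfl⟩⟩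
    rw [this, indicator_of_mem (mem_image_of_mem _ hg)]
    simp
  · have : E ∩ {k | src k = u} = ∅ := by
      ext k
      exact ⟨fun h => hu ⟨k, h.1, h.2⟩, fun h => h.elim⟩
    rw [this, indicator_of_notMem hu]
    simp

variable {G : Type*} [TopologicalSpace G] [ArrowGroupoid G] [MeasurableSpace G]

/-- Each source fibre meets `E` in at most one arrow, so the integrand is the indicator of `src ''
E`. -/
theorem inducedMeasure_eq_of_injOn_src {G : Type*} [ArrowGroupoid G] [MeasurableSpace G]
    (μ : Measure (UnitSpace G)) {E : Set G} (hE : InjOn src E)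
    (hm : MeasurableSet (src '' E)) : inducedMeasure μ E = μ (src '' E) := by
  simp only [inducedMeasure, encard_inter_src_fiber hE]
  exact lintegral_indicator_one hm

/-- Measurable sets of units are approximated in measure by clopen sets. -/
theorem exists_isClopen_measure_diff_lt [IsCantorGroupoid G] [BorelSpace G]
    (μ : Measure (UnitSpace G)) [IsFiniteMeasure μ] {A : Set (UnitSpace G)} (hA : MeasurableSet A) {δ : ℝ≥0∞} (hδ : δ ≠ 0) :
    ∃ U, IsClopen U ∧ μ (A \ U) < δ ∧ μ (U \ A) < δ := by
  have := unitSpace_compactSpace (G := G)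
  have := unitSpace_totallyDisconnectedSpace (G := G)
  have := unitSpace_metrizableSpace (G := G)
  obtain ⟨O, hAO, hO, -, hOA⟩ := hA.exists_isOpen_sdiff_lt (measure_ne_top μ A) hδ
  obtain ⟨K, hKA, hK, hAK⟩ := hA.exists_isClosed_sdiff_lt (measure_ne_top μ A) hδ
  -- Regularity gives a closed `K ⊆ A` and an open `O ⊇ A`; total disconnectedness fits a clopen set
  -- between them.
  obtain ⟨U, hU, hKU, hUO⟩ := exists_clopen_of_closed_subset_open hK hO (hKA.trans hAO)
  exact ⟨U, hU, (measure_mono (sdiff_subset_sdiff_right hKU)).trans_lt hAK,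
    (measure_mono (sdiff_subset_sdiff_left hUO)).trans_lt hOA⟩

variable [IsEtaleGroupoid G] [IsCantorGroupoid G] [BorelSpace G]

theorem TopologicalFullGroup.measurable_smul (B : TopologicalFullGroup G) :
    Measurable fun u : UnitSpace G => B • u := B.continuous_smul.measurable

/-- Quasi-invariance is applied to the arrows of `B` with range in `E`: their sources form the
preimage of `E`, and the sources of their inverses form `E`. -/
theorem IsQuasiInvariant.measure_smul_preimage_eq_zero_iff {μ : Measure (UnitSpace G)}
    (hqi : IsQuasiInvariant μ) (B : TopologicalFullGroup G) {E : Set (UnitSpace G)}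
    (hE : MeasurableSet E) : μ ((fun u => B • u) ⁻¹' E) = 0 ↔ μ E = 0 := by
  have hF : MeasurableSet (B.carrier ∩ rng ⁻¹' E) := B.isCompactOpenSlice.2.1.measurableSet.inter
    ((isLocalHomeomorph_rng G).continuous.measurable hE)
  have hs : src '' (B.carrier ∩ rng ⁻¹' E) = (fun u => B • u) ⁻¹' E := by
    ext u
    constructor
    · rintro ⟨g, ⟨hg, hgE⟩, rfl⟩
      change B • src g ∈ E
      rwa [B.smul_src hg]
    · intro hu
      obtain ⟨g, hg, rfl⟩ := B.exists_src u
      refine ⟨g, ⟨hg, ?_⟩, rfl⟩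
      change B • src g ∈ E at hu
      rwa [B.smul_src hg] at hu
  have hr : rng '' (B.carrier ∩ rng ⁻¹' E) = E := by
    rw [image_inter_preimage, B.rng_image, univ_inter]
  have hinj : InjOn src (setInv (B.carrier ∩ rng ⁻¹' E)) := by
    rintro _ ⟨g, hg, rfl⟩ _ ⟨h, hh, rfl⟩ e
    rw [src_inv, src_inv] at e
    rw [B.isCompactOpenSlice.1.2 hg.1 hh.1 e]
  have h := hqi _ hF
  rwa [inducedMeasure_eq_of_injOn_src μ (B.isCompactOpenSlice.1.1.mono inter_subset_left)
      (hs ▸ B.measurable_smul hE), inducedMeasure_eq_of_injOn_src μ hinj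
      (by rwa [src_image_setInv, hr]), src_image_setInv, hr, hs] at h

theorem IsQuasiInvariant.measureClassPreserving {μ : Measure (UnitSpace G)}
    (hqi : IsQuasiInvariant μ) (B : TopologicalFullGroup G) :
    μ.map (fun u => B • u) ≪ μ ∧ μ ≪ μ.map (fun u => B • u) := by
  constructor <;> refine Measure.AbsolutelyContinuous.mk fun E hE h => ?_
  · rw [Measure.map_apply B.measurable_smul hE]
    exact (hqi.measure_smul_preimage_eq_zero_iff B hE).2 h
  · rw [Measure.map_apply B.measurable_smul hE] at h
    exact (hqi.measure_smul_preimage_eq_zero_iff B hE).1 h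

/-- Of the two disjoint copies of `W` inside `W`, the one of smaller measure has at most half the
measure of `W`. No invariance of `μ` enters. -/
theorem IsPurelyInfinite.exists_isClopen_measure_le (hpi : IsPurelyInfinite G)
    (μ : Measure (UnitSpace G)) {U : Set (UnitSpace G)} (hU : IsClopen U) (hne : U.Nonempty)
    (n : ℕ) : ∃ W ⊆ U, IsClopen W ∧ W.Nonempty ∧ 2 ^ n * μ W ≤ μ U := by
  induction n with
  | zero => exact ⟨U, subset_rfl, hU, hne, by simp⟩
  | succ n ih =>
    obtain ⟨W, hWU, hW, hWne, hμ⟩ := ih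
    obtain ⟨S₁, S₂, h1, h2, hs1, hs2, hr, hd⟩ := hpi W hW
    have hsum : μ (rng '' S₁) + μ (rng '' S₂) ≤ μ W := by
      rw [← measure_union hd h2.isClopen_rng_image.isOpen.measurableSet]
      exact measure_mono hr
    have key : ∀ S : Set G, IsCompactOpenSlice S → src '' S = W → rng '' S ⊆ W →
        μ (rng '' S) + μ (rng '' S) ≤ μ W →
        ∃ W ⊆ U, IsClopen W ∧ W.Nonempty ∧ 2 ^ (n + 1) * μ W ≤ μ U := by
      intro S hS hsS hrS h
      refine ⟨rng '' S, hrS.trans hWU, hS.isClopen_rng_image, ?_, ?_⟩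
      · rw [image_nonempty, ← image_nonempty (f := src), hsS]
        exact hWne
      · rw [pow_succ, _root_.mul_assoc, two_mul]
        exact (mul_le_mul_right h _).trans hμ
    rcases le_total (μ (rng '' S₁)) (μ (rng '' S₂)) with h | h
    · exact key S₁ h1 hs1 (subset_union_left.trans hr) ((add_le_add_right h _).trans hsum)
    · exact key S₂ h2 hs2 (subset_union_right.trans hr) ((add_le_add_left h _).trans hsum)

theorem IsPurelyInfinite.exists_isClopen_measure_lt (hpi : IsPurelyInfinite G)
    (μ : Measure (UnitSpace G)) [IsFiniteMeasure μ] {U : Set (UnitSpace G)} (hU : IsClopen U)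
    (hne : U.Nonempty) {δ : ℝ≥0∞} (hδ : δ ≠ 0) :
    ∃ W ⊆ U, IsClopen W ∧ W.Nonempty ∧ μ W < δ := by
  by_cases hδt : δ = ∞
  · exact ⟨U, subset_rfl, hU, hne, hδt ▸ measure_lt_top μ U⟩
  obtain ⟨n, hn⟩ := ENNReal.exists_nat_mul_gt hδ (measure_ne_top μ U)
  obtain ⟨W, hWU, hW, hWne, h⟩ := hpi.exists_isClopen_measure_le μ hU hne n
  refine ⟨W, hWU, hW, hWne, ?_⟩
  have h2 : (2 : ℝ≥0∞) ^ n * μ W < 2 ^ n * δ := by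
    refine (h.trans_lt hn).trans_le (mul_le_mul_left ?_ _)
    exact_mod_cast Nat.lt_two_pow_self.le
  exact lt_of_mul_lt_mul_left' h2

/-- For every nonempty clopen `U` there is an element of the topological full group supported in
`U` that moves all of `U` but a set of small measure into a set of small measure. -/
theorem exists_topologicalFullGroup_contracting (hpi : IsPurelyInfinite G) (hmin : IsMinimal G)
    (μ : Measure (UnitSpace G)) [IsFiniteMeasure μ] {U : Set (UnitSpace G)} (hU : IsClopen U)
    (hne : U.Nonempty) {δ : ℝ≥0∞} (hδ : δ ≠ 0) :
    ∃ (g : TopologicalFullGroup G) (W : Set (UnitSpace G)), IsClopen W ∧ μ W < δ ∧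
      (∀ u ∉ U, g • u = u) ∧ ∀ u ∈ U \ W, g • u ∈ W := by
  obtain ⟨W, hWU, hW, hWne, hμW⟩ := hpi.exists_isClopen_measure_lt μ hU hne hδ
  obtain ⟨B, hB, hBs, hBr⟩ := exists_isCompactOpenSlice_univ hpi hmin hW hWne
  -- Removing `W` from the source makes it disjoint from the range, which lies in `W`.
  have hC := hB.inter_src_preimage (hU.diff hW)
  have hCs : src '' (B ∩ src ⁻¹' (U \ W)) = U \ W := by
    rw [src_image_inter_preimage, hBs, univ_inter]
  have hCr : rng '' (B ∩ src ⁻¹' (U \ W)) ⊆ W := (image_mono inter_subset_left).trans hBr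
  obtain ⟨g, hg, hg'⟩ := hC.exists_topologicalFullGroup
    (by rw [hCs]; exact disjoint_sdiff_left.mono_right hCr)
  rw [hCs] at hg hg'
  exact ⟨g, W, hW, hμW, fun u hu => hg' u fun h => hu (h.elim (·.1) fun h => hWU (hCr h)),
    fun u hu => hCr (hg u hu)⟩

end Measures

end ArrowGroupoid

/-! ### Markov's inequality for the density, and the main theorem. -/

/-- Markov's inequality on `s`, followed by the bound of the integral of the density by `ν s`; the
latter needs neither absolute continuity nor measurability of `s`. -/
theorem mul_measure_rnDeriv_ge_le {X : Type*} [MeasurableSpace X] (ν μ : Measure X)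
    (s : Set X) (c : ℝ≥0∞) : c * μ (s ∩ {x | c ≤ ν.rnDeriv μ x}) ≤ ν s := by
  have hm : MeasurableSet {x | c ≤ ν.rnDeriv μ x} :=
    measurableSet_le measurable_const (Measure.measurable_rnDeriv ν μ)
  calc c * μ (s ∩ {x | c ≤ ν.rnDeriv μ x})
      = c * (μ.restrict s) {x | c ≤ ν.rnDeriv μ x} := by
        rw [Measure.restrict_apply hm, inter_comm]
    _ ≤ ∫⁻ x in s, ν.rnDeriv μ x ∂μ :=
        mul_meas_ge_le_lintegral (Measure.measurable_rnDeriv ν μ) c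
    _ ≤ ν s := Measure.setLIntegral_rnDeriv_le s

theorem mainTheorem1 {G : Type*} [TopologicalSpace G] [SecondCountableTopology G]
    [ArrowGroupoid G] [ArrowGroupoid.IsEtaleGroupoid G] [ArrowGroupoid.IsCantorGroupoid G]
    [MeasurableSpace G] [BorelSpace G]
    (hpi : ArrowGroupoid.IsPurelyInfinite G) (hmin : ArrowGroupoid.IsMinimal G)
    (μ : Measure (ArrowGroupoid.UnitSpace G)) [IsProbabilityMeasure μ]
    (hqi : ArrowGroupoid.IsQuasiInvariant μ) (herg : ArrowGroupoid.IsErgodic μ) :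
    Countable (ArrowGroupoid.TopologicalFullGroup G) ∧
      IsMeasureContracting (ArrowGroupoid.TopologicalFullGroup G) μ := by
  refine ⟨ArrowGroupoid.TopologicalFullGroup.countable, fun g => g.measurable_smul,
    hqi.measureClassPreserving, fun A hA M ε hM hε => ?_⟩
  have he : ENNReal.ofReal (ε / 4) ≠ 0 := (ENNReal.ofReal_pos.2 (by positivity)).ne'
  have hreal : ∀ {s : Set (ArrowGroupoid.UnitSpace G)}, μ s < ENNReal.ofReal (ε / 4) →
      μ.real s < ε / 4 := ENNReal.toReal_lt_of_lt_ofReal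
  obtain ⟨U, hU, hAU, hUA⟩ := ArrowGroupoid.exists_isClopen_measure_diff_lt μ hA he
  replace hAU := hreal hAU
  replace hUA := hreal hUA
  -- If `U` is empty, then `A` itself has measure below `ε / 4` and the identity works.
  rcases U.eq_empty_or_nonempty with rfl | hne
  · rw [sdiff_empty] at hAU
    refine ⟨1, by simpa using hε, ?_⟩
    have : μ.real A - ε < 0 := by linarith
    exact this.trans_le measureReal_nonneg
  -- The square root of the density is below `M⁻¹` as soon as the density is below `c`.
  let c : ℝ≥0∞ := ENNReal.ofReal M⁻¹ ^ 2
  have hc : c ≠ 0 := pow_ne_zero _ (ENNReal.ofReal_pos.2 (by positivity)).ne'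
  -- The first bound lets `W` be discarded; the second survives division by `c` in Markov's
  -- inequality.
  have hδ : min (ENNReal.ofReal (ε / 4)) (c * ENNReal.ofReal (ε / 4)) ≠ 0 :=
    (lt_min (pos_iff_ne_zero.2 he) (pos_iff_ne_zero.2 (mul_ne_zero hc he))).ne'
  obtain ⟨g, W, hW, hμW, hsupp, hg⟩ :=
    ArrowGroupoid.exists_topologicalFullGroup_contracting hpi hmin μ hU hne hδ
  obtain ⟨hμW, hμW'⟩ := lt_min_iff.1 hμW
  have hgU : {x | g • x ≠ x} ⊆ U := fun x hx => by_contra fun h => hx (hsupp x h)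
  refine ⟨g, (measureReal_mono (sdiff_subset_sdiff_left hgU)).trans_lt
    (hUA.trans (by linarith)), ?_⟩
  set ν := μ.map fun y => g⁻¹ • y with hν
  have hνW : ν (U \ W) ≤ μ W := by
    rw [hν, Measure.map_apply g⁻¹.measurable_smul (hU.diff hW).isOpen.measurableSet]
    refine measure_mono fun x hx => ?_
    simpa using hg _ hx
  have hbad : μ.real (U \ W ∩ {x | c ≤ ν.rnDeriv μ x}) < ε / 4 :=
    hreal (lt_of_mul_lt_mul_left'
      ((mul_measure_rnDeriv_ge_le ν μ (U \ W) c).trans_lt (hνW.trans_lt hμW')))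
  -- Three exceptional sets, each of measure below `ε / 4`.
  have hcover : A ⊆ {x ∈ A | ν.rnDeriv μ x ^ (1 / 2 : ℝ) < ENNReal.ofReal M⁻¹} ∪ A \ U ∪ W ∪
      (U \ W ∩ {x | c ≤ ν.rnDeriv μ x}) := by
    intro x hx
    by_cases hxU : x ∈ U
    · by_cases hxW : x ∈ W
      · exact Or.inl (Or.inr hxW)
      rcases le_or_gt c (ν.rnDeriv μ x) with h | h
      · exact Or.inr ⟨⟨hxU, hxW⟩, h⟩
      · refine Or.inl (Or.inl (Or.inl ⟨hx, ?_⟩))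
        refine (ENNReal.rpow_lt_rpow h (by norm_num)).trans_eq ?_
        change (ENNReal.ofReal M⁻¹ ^ 2) ^ (1 / 2 : ℝ) = _
        rw [← ENNReal.rpow_natCast, ← ENNReal.rpow_mul, Nat.cast_ofNat,
          mul_one_div_cancel two_ne_zero, ENNReal.rpow_one]
    · exact Or.inl (Or.inl (Or.inr ⟨hx, hxU⟩))
  have h1 := (measureReal_mono (μ := μ) hcover).trans (measureReal_union_le _ _)
  have h2 := measureReal_union_le (μ := μ)
    ({x ∈ A | ν.rnDeriv μ x ^ (1 / 2 : ℝ) < ENNReal.ofReal M⁻¹} ∪ A \ U) W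
  have h3 := measureReal_union_le (μ := μ)
    {x ∈ A | ν.rnDeriv μ x ^ (1 / 2 : ℝ) < ENNReal.ofReal M⁻¹} (A \ U)
  have h4 := hreal hμW
  linarith
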